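/- A randomized query algorithm for a function $g:\{0,1\}^m\to S$ is a probability distribution over deterministic decision trees that query the coordinates of the input $x\in\{0,1\}^m$ and output an element of $S$. It computes $g$ with error $\varepsilon$ if on every input $x$ it outputs $g(x)$ with probability at least $1-\varepsilon$, and its average query cost is the maximum, over all inputs $x$, of the expected number of coordinates of $x$ that it queries. Let $\overline{\mathrm{R}}_\varepsilon(g)$, the average $\varepsilon$-error randomized query complexity of $g$, be the least (infimum) average query cost of a randomized algorithm that computes $g$ with error $\varepsilon$. For $f:\{0,1\}^n\to\{0,1\}$ and $k\ge 2$ define $f^k:\{0,1\}^{nk}\to\{0,1\}^k$ by $f^k(x^{(1)},\dots,x^{(k)})=(f(x^{(1)}),\dots,f(x^{(k)}))$. Theorem. There is an absolute constant $c>0$ such that for every $n$, every function $f:\{0,1\}^n\to\{0,1\}$, every integer $k\ge 2$ and every real $0\le\varepsilon\le\frac1{20}$, $$\overline{\mathrm{R}}_\varepsilon(f^k)\;\ge\; c\cdot k\cdot \overline{\mathrm{R}}_{\varepsilon/k}(f).$$ -/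

import Mathlib

open scoped ENNReal NNReal

/-- Deterministic query algorithms (decision trees) for inputs `x : ι → Bool`, with outputs in `α`.
A node `query i next` reads the bit `x i` and continues with `next (x i)`. -/
inductive DecisionTree (ι α : Type) : Type
  | leaf (a : α) : DecisionTree ι α
  | query (i : ι) (next : Bool → DecisionTree ι α) : DecisionTree ι α

namespace DecisionTree

/-- The output of the tree on input `x`. -/
def eval {ι α : Type} : DecisionTree ι α → (ι → Bool) → α
  | leaf a, _ => a
  | query i next, x => (next (x i)).eval x

/-- The set of coordinates of `x` that the tree queries on input `x`. -/
def queried {ι α : Type} [DecidableEq ι] : DecisionTree ι α → (ι → Bool) → Finset ι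
  | leaf _, _ => ∅
  | query i next, x => insert i ((next (x i)).queried x)

end DecisionTree

/-- A randomized query algorithm: a probability distribution over decision trees. -/
abbrev RandomizedAlgorithm (ι α : Type) : Type := PMF (DecisionTree ι α)

noncomputable section

namespace RandomizedAlgorithm

/-- The distribution of the output of `A` on input `x`. -/
def outputDist {ι α : Type} (A : RandomizedAlgorithm ι α) (x : ι → Bool) : PMF α :=
  PMF.map (fun T : DecisionTree ι α => T.eval x) A

/-- `A` computes `g` with error `ε`: on every input `x` it outputs `g x` with probability at
least `1 - ε`. -/
def Computes {ι α : Type} (A : RandomizedAlgorithm ι α) (g : (ι → Bool) → α) (ε : ℝ) : Prop :=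
  ∀ x : ι → Bool, 1 - ε ≤ (A.outputDist x (g x)).toReal

/-- The expected number of coordinates of `x` that `A` queries on input `x`. -/
def expectedQueries {ι α : Type} [DecidableEq ι] (A : RandomizedAlgorithm ι α) (x : ι → Bool) :
    ℝ≥0∞ :=
  ∑' T : DecisionTree ι α, A T * ((T.queried x).card : ℝ≥0∞)

/-- The average query cost of `A`: the maximum over all inputs of the expected number of
coordinates queried. -/
def averageCost {ι α : Type} [DecidableEq ι] (A : RandomizedAlgorithm ι α) : ℝ≥0∞ :=
  ⨆ x : ι → Bool, A.expectedQueries x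

end RandomizedAlgorithm

/-- The average `ε`-error randomized query complexity of `g`: the least average query cost of a
randomized algorithm that computes `g` with error `ε`. -/
def avgQueryComplexity {ι α : Type} [DecidableEq ι] (ε : ℝ) (g : (ι → Bool) → α) : ℝ≥0∞ :=
  ⨅ (A : RandomizedAlgorithm ι α) (_ : A.Computes g ε), A.averageCost

end

/-- The `k`-fold function `f^k (x⁽¹⁾, …, x⁽ᵏ⁾) = (f x⁽¹⁾, …, f x⁽ᵏ⁾)`; bit `j` of the `i`-th
instance is the coordinate `(i, j)`. -/
def kFold {n : ℕ} (f : (Fin n → Bool) → Bool) (k : ℕ) (x : Fin k × Fin n → Bool) : Fin k → Bool :=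
  fun i => f (fun j => x (i, j))

/-! Let `A` compute `f^k` with error `ε` and average cost `q`. Hide an input `x` of `f` at a
position `i` among known instances, run `A`, and decline to answer unless all output bits before `i`
are correct. A wrong answer then means that `i` is the first wrong position. These events are
disjoint over `i`, so their probabilities sum to at most `ε`; the costs of the blocks sum to at most
`q`. Averaging over `i` and a product distribution, followed by minimax (`exists_mixed_embedding`),
gives an algorithm with worst-case error `2ε/k`, cost `2q/k` and declining probability `ε`
(`exists_declining_algorithm`).

To bring the error from `2ε/k` down to `ε/k`, run it twice and accept only a common answer;
otherwise call an algorithm `B` for `f` with error `ε/k`. Two wrong runs have probability at most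
`(2ε/k)²`, and `B` is called with probability at most `1/5`. Letting `B` approach the optimum `R`
gives `R ≤ 4q/k + R/5`, that is `R ≤ 5q/k`. -/

namespace DecisionTree

/-! ### Operations on decision trees -/

variable {ι α β : Type}

/-- Run `T` and continue with the tree selected by its output. -/
def bind : DecisionTree ι α → (α → DecisionTree ι β) → DecisionTree ι β
  | leaf a, g => g a
  | query i next, g => query i fun b => (next b).bind g

theorem eval_bind (T : DecisionTree ι α) (g : α → DecisionTree ι β) (x : ι → Bool) :
    (T.bind g).eval x = (g (T.eval x)).eval x := by
  induction T with
  | leaf a => rfl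
  | query i next ih => exact ih (x i)

theorem queried_bind [DecidableEq ι] (T : DecisionTree ι α) (g : α → DecisionTree ι β)
    (x : ι → Bool) : (T.bind g).queried x = T.queried x ∪ (g (T.eval x)).queried x := by
  induction T with
  | leaf a => simp [bind, queried, eval]
  | query i next ih => simp [bind, queried, eval, ih]

/-- Query the coordinates of `l`, then output `g` of the input, with the coordinates outside `l`
taken from `z`. -/
def readList [DecidableEq ι] (g : (ι → Bool) → α) : List ι → (ι → Bool) → DecisionTree ι α
  | [], z => leaf (g z)
  | i :: l, z => query i fun b => readList g l (Function.update z i b)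

theorem eval_readList [DecidableEq ι] (g : (ι → Bool) → α) (x : ι → Bool) (l : List ι)
    (z : ι → Bool) : (readList g l z).eval x = g fun i => if i ∈ l then x i else z i := by
  induction l generalizing z with
  | nil => simp [readList, eval]
  | cons i l ih =>
    simp only [readList, eval, ih]
    congr 1
    funext j
    by_cases hj : j ∈ l
    · simp [hj]
    · by_cases hji : j = i
      · subst hji; simp [hj]
      · simp [hj, hji]

/-- Run a tree for a family of instances on the family `y`, with the actual input in place of the
instance `i`. -/
def restrict {κ : Type} [DecidableEq κ] (i : κ) (y : κ → ι → Bool) :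
    DecisionTree (κ × ι) α → DecisionTree ι α
  | leaf a => leaf a
  | query p next =>
    if p.1 = i then query p.2 fun b => (next b).restrict i y
    else (next (y p.1 p.2)).restrict i y

theorem eval_restrict {κ : Type} [DecidableEq κ] (i : κ) (y : κ → ι → Bool)
    (T : DecisionTree (κ × ι) α) (x : ι → Bool) :
    (T.restrict i y).eval x = T.eval (Function.uncurry (Function.update y i x)) := by
  induction T with
  | leaf a => rfl
  | query p next ih =>
    obtain ⟨i', j⟩ := p
    by_cases h : i' = i
    · subst h; simp [restrict, eval, ih]
    · simp [restrict, eval, ih, h]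

theorem mem_queried_restrict {κ : Type} [DecidableEq κ] [DecidableEq ι] (i : κ)
    (y : κ → ι → Bool) (T : DecisionTree (κ × ι) α) (x : ι → Bool) (j : ι) :
    j ∈ (T.restrict i y).queried x ↔
      (i, j) ∈ T.queried (Function.uncurry (Function.update y i x)) := by
  induction T with
  | leaf a => simp [restrict, queried]
  | query p next ih =>
    obtain ⟨i', j'⟩ := p
    by_cases h : i' = i
    · subst h; simp [restrict, queried, ih]
    · simp [restrict, queried, ih, h, Ne.symm h]

/-- Run `T` and `T'`; if they agree on a definite output, return it, and run `S` otherwise. -/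
def agreeOr [DecidableEq α] (T T' : DecisionTree ι (Option α)) (S : DecisionTree ι α) :
    DecisionTree ι α :=
  T.bind fun o => T'.bind fun o' =>
    match o with
    | some a => if o' = some a then leaf a else S
    | none => S

/-- The number of queries of a tree for a family of instances that concern the instance `i`. -/
def blockCost {κ : Type} [DecidableEq κ] [DecidableEq ι] (T : DecisionTree (κ × ι) α) (i : κ)
    (z : κ → ι → Bool) : ℕ :=
  ((T.queried (Function.uncurry z)).filter fun p => p.1 = i).card

theorem sum_blockCost {κ : Type} [Fintype κ] [DecidableEq κ] [DecidableEq ι]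
    (T : DecisionTree (κ × ι) α) (z : κ → ι → Bool) :
    ∑ i, T.blockCost i z = (T.queried (Function.uncurry z)).card :=
  (Finset.card_eq_sum_card_fiberwise fun _ _ => Finset.mem_coe.2 (Finset.mem_univ _)).symm

theorem card_queried_restrict {κ : Type} [DecidableEq κ] [DecidableEq ι] (i : κ)
    (y : κ → ι → Bool) (T : DecisionTree (κ × ι) α) (x : ι → Bool) :
    ((T.restrict i y).queried x).card = T.blockCost i (Function.update y i x) := by
  have h : (T.queried (Function.uncurry (Function.update y i x))).filter (fun p => p.1 = i) =
      ((T.restrict i y).queried x).image (Prod.mk i) := by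
    ext ⟨i', j⟩
    simp only [Finset.mem_filter, Finset.mem_image, mem_queried_restrict, Prod.mk.injEq]
    constructor
    · rintro ⟨h, rfl⟩; exact ⟨j, h, rfl, rfl⟩
    · rintro ⟨j, h, rfl, rfl⟩; exact ⟨h, rfl⟩
  rw [blockCost, h, Finset.card_image_of_injective _ (Prod.mk_right_injective i)]

end DecisionTree

/-! ### Expectations with values in `[0, ∞]` -/

namespace PMF

variable {α β : Type*}

/-- The expectation of a function with values in `[0, ∞]`. -/
noncomputable def expect (p : PMF α) (F : α → ℝ≥0∞) : ℝ≥0∞ := ∑' a, p a * F a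

theorem expect_mono (p : PMF α) {F G : α → ℝ≥0∞} (h : ∀ a, F a ≤ G a) :
    p.expect F ≤ p.expect G :=
  ENNReal.tsum_le_tsum fun a => by gcongr; exact h a

theorem expect_const (p : PMF α) (c : ℝ≥0∞) : p.expect (fun _ => c) = c := by
  simp [expect, ENNReal.tsum_mul_right]

theorem expect_add (p : PMF α) (F G : α → ℝ≥0∞) :
    p.expect (fun a => F a + G a) = p.expect F + p.expect G := by
  simp [expect, mul_add, ENNReal.tsum_add]

theorem expect_const_mul (p : PMF α) (c : ℝ≥0∞) (F : α → ℝ≥0∞) :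
    p.expect (fun a => c * F a) = c * p.expect F := by
  simp [expect, mul_left_comm _ c, ENNReal.tsum_mul_left]

theorem expect_mul_const (p : PMF α) (c : ℝ≥0∞) (F : α → ℝ≥0∞) :
    p.expect (fun a => F a * c) = p.expect F * c := by
  simp [expect, ← mul_assoc, ENNReal.tsum_mul_right]

theorem expect_sum {ι : Type*} (p : PMF α) (s : Finset ι) (F : ι → α → ℝ≥0∞) :
    p.expect (fun a => ∑ i ∈ s, F i a) = ∑ i ∈ s, p.expect (F i) := by
  simp only [expect, Finset.mul_sum]
  exact Summable.tsum_finsetSum fun _ _ => ENNReal.summable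

theorem expect_le (p : PMF α) {F : α → ℝ≥0∞} {c : ℝ≥0∞} (h : ∀ a, F a ≤ c) : p.expect F ≤ c :=
  (p.expect_mono h).trans_eq (p.expect_const c)

theorem expect_bind (p : PMF α) (g : α → PMF β) (F : β → ℝ≥0∞) :
    (p.bind g).expect F = p.expect fun a => (g a).expect F := by
  simp only [expect, bind_apply, ← ENNReal.tsum_mul_right, ← ENNReal.tsum_mul_left]
  rw [ENNReal.tsum_comm]
  simp [mul_assoc]

theorem expect_pure (a : α) (F : α → ℝ≥0∞) : (pure a).expect F = F a := by
  classical
  simp [expect, pure_apply]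

theorem expect_map (p : PMF α) (g : α → β) (F : β → ℝ≥0∞) :
    (p.map g).expect F = p.expect fun a => F (g a) := by
  rw [← bind_pure_comp, expect_bind]
  simp [expect_pure]

theorem apply_add_expect_ne [DecidableEq α] (p : PMF α) (a : α) :
    p a + p.expect (fun b => if b = a then 0 else 1) = 1 := by
  have h : p a = p.expect fun b => if b = a then 1 else 0 := by simp [expect]
  rw [h, ← expect_add]
  refine Eq.trans ?_ (expect_const p 1)
  congr 1
  funext b
  split_ifs <;> simp

end PMF

theorem RandomizedAlgorithm.computes_iff {ι α : Type} [DecidableEq α] (A : RandomizedAlgorithm ι α)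
    (g : (ι → Bool) → α) {ε : ℝ} (hε : 0 ≤ ε) :
    A.Computes g ε ↔
      ∀ x, A.expect (fun T => if T.eval x = g x then 0 else 1) ≤ ENNReal.ofReal ε := by
  refine forall_congr' fun x => ?_
  have h := (A.outputDist x).apply_add_expect_ne (g x)
  rw [outputDist, PMF.expect_map] at h
  rw [outputDist]
  generalize A.expect (fun T => if T.eval x = g x then 0 else 1) = e at *
  generalize (PMF.map (fun T : DecisionTree ι α => T.eval x) A) (g x) = s at *
  have hs : s ≠ ∞ := fun hs => by simp [hs] at h
  have he : e ≠ ∞ := fun he => by simp [he] at h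
  have h' := congrArg ENNReal.toReal h
  rw [ENNReal.toReal_add hs he, ENNReal.toReal_one] at h'
  rw [← ENNReal.ofReal_toReal he, ENNReal.ofReal_le_ofReal_iff hε]
  constructor <;> intro <;> linarith

theorem RandomizedAlgorithm.expectedQueries_eq {ι α : Type} [DecidableEq ι]
    (A : RandomizedAlgorithm ι α) (x : ι → Bool) :
    A.expectedQueries x = A.expect fun T => ((T.queried x).card : ℝ≥0∞) := rfl

/-! ### Minimax and embedding one instance among many -/

/-- The minimax theorem for finite matrix games. -/
theorem exists_mixed_strategy {I X : Type*} [Fintype I] [Fintype X] [Nonempty X]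
    (M : I → X → ℝ) (v : ℝ)
    (h : ∀ μ ∈ stdSimplex ℝ X, ∃ i, ∑ x, μ x * M i x ≤ v) :
    ∃ w ∈ stdSimplex ℝ I, ∀ x, ∑ i, w i * M i x ≤ v := by
  classical
  obtain ⟨x₀⟩ := ‹Nonempty X›
  -- `I` is nonempty because some `i` must answer a point mass.
  obtain ⟨i₀, -⟩ := h _ (single_mem_stdSimplex ℝ x₀)
  let B : (I → ℝ) → (X → ℝ) → ℝ := fun w μ => ∑ i, ∑ x, w i * μ x * M i x
  have hwB (μ : X → ℝ) : IsLinearMap ℝ fun w => B w μ :=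
    ⟨fun w w' => by simp [B, add_mul, Finset.sum_add_distrib],
      fun c w => by simp [B, Finset.mul_sum, mul_assoc]⟩
  have hμB (w : I → ℝ) : IsLinearMap ℝ fun μ => B w μ :=
    ⟨fun μ μ' => by simp [B, mul_add, add_mul, Finset.sum_add_distrib],
      fun c μ => by simp [B, Finset.mul_sum, mul_assoc, mul_left_comm c]⟩
  have hcw (μ : X → ℝ) : Continuous fun w => B w μ := by fun_prop
  have hcμ (w : I → ℝ) : Continuous fun μ => B w μ := by fun_prop
  obtain ⟨w, hw, μ, hμ, hsaddle⟩ := Sion.exists_isSaddlePointOn (f := B)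
    ⟨_, single_mem_stdSimplex ℝ i₀⟩ (convex_stdSimplex ℝ I) (isCompact_stdSimplex ℝ I)
    (fun μ _ => (hcw μ).lowerSemicontinuous.lowerSemicontinuousOn _)
    (fun μ _ => ((hwB μ).mk' _).convexOn (convex_stdSimplex ℝ I) |>.quasiconvexOn)
    (convex_stdSimplex ℝ X) ⟨_, single_mem_stdSimplex ℝ x₀⟩ (isCompact_stdSimplex ℝ X)
    (fun w _ => (hcμ w).upperSemicontinuous.upperSemicontinuousOn _)
    (fun w _ => ((hμB w).mk' _).concaveOn (convex_stdSimplex ℝ X) |>.quasiconcaveOn)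
  obtain ⟨i, hi⟩ := h μ hμ
  refine ⟨w, hw, fun x => ?_⟩
  -- The saddle point compares `w` against pure `x` with the reply `i` against `μ`.
  have := hsaddle _ (single_mem_stdSimplex ℝ i) _ (single_mem_stdSimplex ℝ x)
  simp only [B, Pi.single_apply, mul_ite, ite_mul, mul_one, one_mul, mul_zero, zero_mul,
    Finset.sum_ite_eq', Finset.sum_ite_irrel, Finset.sum_const_zero, Finset.mem_univ,
    if_true] at this
  exact this.trans hi

/-- Resampling one coordinate does not change a product distribution. -/
theorem sum_prod_mul_update {ι X : Type*} [Fintype ι] [DecidableEq ι] [Fintype X] (μ : X → ℝ)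
    (hμ : ∑ x, μ x = 1) (i : ι) (G : (ι → X) → ℝ) :
    ∑ y : ι → X, (∏ j, μ (y j)) * ∑ x, μ x * G (Function.update y i x) =
      ∑ y : ι → X, (∏ j, μ (y j)) * G y := by
  have hswap : ∑ p : (ι → X) × X, (∏ j, μ (p.1 j)) * (μ p.2 * G (Function.update p.1 i p.2)) =
      ∑ p : (ι → X) × X, (∏ j, μ (p.1 j)) * (μ p.2 * G p.1) := by
    -- Exchanging `y i` with the fresh sample is an involution that preserves the product weight.
    let σ : (ι → X) × X → (ι → X) × X := fun p => (Function.update p.1 i p.2, p.1 i)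
    have hσ : Function.Involutive σ := fun p => by simp [σ]
    refine Fintype.sum_equiv hσ.toPerm _ _ fun p => ?_
    have key (y : ι → X) : ∏ j, μ (y j) = μ (y i) * ∏ j ∈ Finset.univ.erase i, μ (y j) :=
      (Finset.mul_prod_erase _ _ (Finset.mem_univ i)).symm
    have hrest : ∏ j ∈ Finset.univ.erase i, μ (Function.update p.1 i p.2 j) =
        ∏ j ∈ Finset.univ.erase i, μ (p.1 j) :=
      Finset.prod_congr rfl fun j hj => by
        rw [Function.update_of_ne (Finset.ne_of_mem_erase hj)]
    simp only [Function.Involutive.coe_toPerm, σ]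
    rw [key p.1, key (Function.update p.1 i p.2), hrest, Function.update_self]
    ring
  simp only [Fintype.sum_prod_type] at hswap
  simp only [Finset.mul_sum]
  rw [hswap]
  refine Finset.sum_congr rfl fun y _ => ?_
  rw [← Finset.mul_sum, ← Finset.sum_mul, hμ, one_mul]

/-- If the costs `G i y` of the coordinates of `y` add up to at most `s`, then, for inputs drawn
from `μ`, some embedding as the coordinate `i` of a fixed `y` has average cost at most
`s / card ι`. -/
theorem exists_embedding_le {ι X : Type*} [Fintype ι] [DecidableEq ι] [Nonempty ι] [Fintype X]
    (G : ι → (ι → X) → ℝ) (s : ℝ) (hG : ∀ y, ∑ i, G i y ≤ s) (μ : X → ℝ)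
    (hμ : μ ∈ stdSimplex ℝ X) :
    ∃ p : ι × (ι → X),
      ∑ x, μ x * G p.1 (Function.update p.2 p.1 x) ≤ s / Fintype.card ι := by
  -- Averaging argument: take the position uniform and `y` from the product distribution `μ^ι`.
  by_contra! hcon
  have hw0 (y : ι → X) : 0 ≤ ∏ j, μ (y j) := Finset.prod_nonneg fun j _ => hμ.1 _
  have hw1 : ∑ y : ι → X, ∏ j, μ (y j) = 1 := by
    rw [← Fintype.piFinset_univ, Finset.sum_prod_piFinset]
    simp [hμ.2]
  have hupper : ∑ i, ∑ y : ι → X, (∏ j, μ (y j)) * ∑ x, μ x * G i (Function.update y i x) ≤ s := by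
    simp only [sum_prod_mul_update μ hμ.2]
    rw [Finset.sum_comm]
    simp only [← Finset.mul_sum]
    calc _ ≤ ∑ y : ι → X, (∏ j, μ (y j)) * s :=
          Finset.sum_le_sum fun y _ => mul_le_mul_of_nonneg_left (hG y) (hw0 y)
      _ = s := by rw [← Finset.sum_mul, hw1, one_mul]
  have hlower (i : ι) : s / Fintype.card ι <
      ∑ y : ι → X, (∏ j, μ (y j)) * ∑ x, μ x * G i (Function.update y i x) := by
    calc s / Fintype.card ι = ∑ y : ι → X, (∏ j, μ (y j)) * (s / Fintype.card ι) := by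
          rw [← Finset.sum_mul, hw1, one_mul]
      _ < _ := by
          refine Finset.sum_lt_sum
            (fun y _ => mul_le_mul_of_nonneg_left (hcon (i, y)).le (hw0 y)) ?_
          obtain ⟨y, -, hy⟩ : ∃ y ∈ Finset.univ, (∏ j, μ ((y : ι → X) j)) ≠ 0 :=
            Finset.exists_ne_zero_of_sum_ne_zero (by rw [hw1]; exact one_ne_zero)
          exact ⟨y, Finset.mem_univ y,
            mul_lt_mul_of_pos_left (hcon (i, y)) ((hw0 y).lt_of_ne' hy)⟩
  have := Finset.sum_lt_sum_of_nonempty (Finset.univ_nonempty (α := ι)) fun i _ => hlower i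
  rw [Finset.sum_const, Finset.card_univ, nsmul_eq_mul,
    mul_div_cancel₀ _ (Nat.cast_ne_zero.2 Fintype.card_ne_zero)] at this
  exact absurd hupper this.not_ge

/-- Given two nonnegative costs, of total at most `α` and `β` on each family of inputs, there is a
distribution over embeddings for which every input has both expected costs at most twice the average
over the coordinates. -/
theorem exists_mixed_embedding {ι X : Type*} [Fintype ι] [DecidableEq ι] [Nonempty ι] [Fintype X]
    [Nonempty X] (a b : ι → (ι → X) → ℝ) (α β : ℝ) (ha : ∀ i y, 0 ≤ a i y)
    (hb : ∀ i y, 0 ≤ b i y) (hα : ∀ y, ∑ i, a i y ≤ α) (hβ : ∀ y, ∑ i, b i y ≤ β) :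
    ∃ w ∈ stdSimplex ℝ (ι × (ι → X)), ∀ x,
      ∑ p, w p * a p.1 (Function.update p.2 p.1 x) ≤ 2 * α / Fintype.card ι ∧
      ∑ p, w p * b p.1 (Function.update p.2 p.1 x) ≤ 2 * β / Fintype.card ι := by
  have y₀ : ι → X := fun _ => Classical.arbitrary X
  have hdiv (c : ι → (ι → X) → ℝ) (γ : ℝ) (hc : ∀ i y, 0 ≤ c i y) (hγ : ∀ y, ∑ i, c i y ≤ γ)
      (y : ι → X) : ∑ i, c i y / γ ≤ 1 := by
    rw [← Finset.sum_div]
    exact div_le_one_of_le₀ (hγ y) ((Finset.sum_nonneg fun i _ => hc i y).trans (hγ y))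
  -- Each cost is divided by its bound, so the sum totals at most 2. One minimax strategy for the
  -- sum controls both costs, as they are nonnegative; this is where the factor 2 arises.
  obtain ⟨w, hw, h⟩ := exists_mixed_strategy
    (fun (p : ι × (ι → X)) x => a p.1 (Function.update p.2 p.1 x) / α +
      b p.1 (Function.update p.2 p.1 x) / β) (2 / Fintype.card ι)
    (fun μ hμ => exists_embedding_le (fun i y => a i y / α + b i y / β) 2 (fun y => by
      rw [Finset.sum_add_distrib]
      linarith [hdiv a α ha hα y, hdiv b β hb hβ y]) μ hμ)
  have hbound (c d : ι → (ι → X) → ℝ) (γ δ : ℝ) (hc : ∀ i y, 0 ≤ c i y) (hd : ∀ i y, 0 ≤ d i y)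
      (hγ : ∀ y, ∑ i, c i y ≤ γ) (hδ : 0 ≤ δ) (x : X)
      (hx : ∑ p, w p * (c p.1 (Function.update p.2 p.1 x) / γ +
        d p.1 (Function.update p.2 p.1 x) / δ) ≤ 2 / Fintype.card ι) :
      ∑ p, w p * c p.1 (Function.update p.2 p.1 x) ≤ 2 * γ / Fintype.card ι := by
    -- For `γ = 0` the quotient by `γ` carries no information, but then the cost vanishes
    -- identically.
    rcases ((Finset.sum_nonneg fun i _ => hc i y₀).trans (hγ y₀)).eq_or_lt with h0 | hpos
    · have hzero (i : ι) (y : ι → X) : c i y = 0 :=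
        le_antisymm ((Finset.single_le_sum (fun i _ => hc i y) (Finset.mem_univ i)).trans
          ((hγ y).trans h0.ge)) (hc i y)
      simp [hzero, ← h0]
    · have h1 : ∑ p, w p * (c p.1 (Function.update p.2 p.1 x) / γ) ≤ 2 / Fintype.card ι :=
        le_trans (Finset.sum_le_sum fun p _ => mul_le_mul_of_nonneg_left
          (le_add_of_nonneg_right (div_nonneg (hd _ _) hδ)) (hw.1 p)) hx
      simp only [← mul_div_assoc, ← Finset.sum_div] at h1
      rw [div_le_iff₀ hpos] at h1
      exact h1.trans_eq (by ring)
  refine ⟨w, hw, fun x => ⟨hbound a b α β ha hb hα ?_ x (h x), hbound b a β α hb ha hβ ?_ x ?_⟩⟩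
  · exact (Finset.sum_nonneg fun i _ => hb i y₀).trans (hβ y₀)
  · exact (Finset.sum_nonneg fun i _ => ha i y₀).trans (hα y₀)
  · simpa only [add_comm] using h x

/-- Version of `exists_mixed_embedding` for costs in `[0, ∞]`. -/
theorem exists_embedding_distribution {ι X : Type*} [Fintype ι] [DecidableEq ι] [Nonempty ι]
    [Fintype X] [Nonempty X] (a b : ι → (ι → X) → ℝ≥0∞) (α β : ℝ≥0∞) (hα' : α ≠ ∞) (hβ' : β ≠ ∞)
    (hα : ∀ y, ∑ i, a i y ≤ α) (hβ : ∀ y, ∑ i, b i y ≤ β) :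
    ∃ P : PMF (ι × (ι → X)), ∀ x,
      P.expect (fun p => a p.1 (Function.update p.2 p.1 x)) ≤ 2 * α / Fintype.card ι ∧
      P.expect (fun p => b p.1 (Function.update p.2 p.1 x)) ≤ 2 * β / Fintype.card ι := by
  have hfin (c : ι → (ι → X) → ℝ≥0∞) (γ : ℝ≥0∞) (hγ' : γ ≠ ∞) (hγ : ∀ y, ∑ i, c i y ≤ γ) (i : ι)
      (y : ι → X) : c i y ≠ ∞ :=
    ne_top_of_le_ne_top hγ' ((Finset.single_le_sum (fun _ _ => zero_le)
      (Finset.mem_univ i)).trans (hγ y))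
  have hsum (c : ι → (ι → X) → ℝ≥0∞) (γ : ℝ≥0∞) (hγ' : γ ≠ ∞) (hγ : ∀ y, ∑ i, c i y ≤ γ)
      (y : ι → X) : ∑ i, (c i y).toReal ≤ γ.toReal := by
    rw [← ENNReal.toReal_sum fun i _ => hfin c γ hγ' hγ i y]
    exact ENNReal.toReal_mono hγ' (hγ y)
  obtain ⟨w, hw, h⟩ := exists_mixed_embedding (fun i y => (a i y).toReal)
    (fun i y => (b i y).toReal) α.toReal β.toReal (fun _ _ => ENNReal.toReal_nonneg)
    (fun _ _ => ENNReal.toReal_nonneg) (hsum a α hα' hα) (hsum b β hβ' hβ)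
  let P : PMF (ι × (ι → X)) := PMF.ofFintype (fun p => ENNReal.ofReal (w p)) (by
    rw [← ENNReal.ofReal_sum_of_nonneg fun p _ => hw.1 p, hw.2, ENNReal.ofReal_one])
  have hP (c : ι → (ι → X) → ℝ≥0∞) (γ : ℝ≥0∞) (hγ' : γ ≠ ∞) (hγ : ∀ y, ∑ i, c i y ≤ γ) (x : X)
      (hx : ∑ p, w p * (c p.1 (Function.update p.2 p.1 x)).toReal ≤
        2 * γ.toReal / Fintype.card ι) :
      P.expect (fun p => c p.1 (Function.update p.2 p.1 x)) ≤ 2 * γ / Fintype.card ι := by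
    have hcard : (Fintype.card ι : ℝ≥0∞) ≠ 0 := Nat.cast_ne_zero.2 Fintype.card_ne_zero
    have hterm (p : ι × (ι → X)) : P p * c p.1 (Function.update p.2 p.1 x) =
        ENNReal.ofReal (w p * (c p.1 (Function.update p.2 p.1 x)).toReal) := by
      rw [ENNReal.ofReal_mul (hw.1 p), ENNReal.ofReal_toReal (hfin c γ hγ' hγ _ _)]
      rfl
    rw [PMF.expect, tsum_fintype, Finset.sum_congr rfl fun p _ => hterm p,
      ← ENNReal.ofReal_sum_of_nonneg fun p _ => mul_nonneg (hw.1 p) ENNReal.toReal_nonneg]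
    refine ENNReal.ofReal_le_of_le_toReal (hx.trans_eq ?_)
    rw [ENNReal.toReal_div, ENNReal.toReal_mul]
    simp
  exact ⟨P, fun x => ⟨hP a α hα' hα x (h x).1, hP b β hβ' hβ x (h x).2⟩⟩

/-! ### From `f^k` to an algorithm for `f` that may decline -/

/-- Run a tree for `f^k` on the instances `y`, with the actual input as the instance `i`; return the
bit `i` of the output if all earlier bits are correct, and no answer otherwise. -/
def DecisionTree.probe {n k : ℕ} (f : (Fin n → Bool) → Bool) (i : Fin k)
    (y : Fin k → Fin n → Bool) (T : DecisionTree (Fin k × Fin n) (Fin k → Bool)) :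
    DecisionTree (Fin n) (Option Bool) :=
  (T.restrict i y).bind fun o => leaf (if ∀ j < i, o j = f (y j) then some (o i) else none)

theorem DecisionTree.card_queried_probe {n k : ℕ} (f : (Fin n → Bool) → Bool) (i : Fin k)
    (y : Fin k → Fin n → Bool) (T : DecisionTree (Fin k × Fin n) (Fin k → Bool))
    (x : Fin n → Bool) :
    ((T.probe f i y).queried x).card = T.blockCost i (Function.update y i x) := by
  rw [← card_queried_restrict, probe, queried_bind, queried, Finset.union_empty]

theorem DecisionTree.eval_probe {n k : ℕ} (f : (Fin n → Bool) → Bool) (i : Fin k)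
    (y : Fin k → Fin n → Bool) (T : DecisionTree (Fin k × Fin n) (Fin k → Bool))
    (x : Fin n → Bool) :
    (T.probe f i y).eval x =
      if ∀ j < i, T.eval (Function.uncurry (Function.update y i x)) j =
        f (Function.update y i x j)
      then some (T.eval (Function.uncurry (Function.update y i x)) i) else none := by
  rw [probe, eval_bind, eval_restrict, eval]
  refine if_congr (forall₂_congr fun j hj => ?_) rfl rfl
  rw [Function.update_of_ne hj.ne]

/-- There is at most one first disagreement. This disjointness is what makes the error, like the
cost, split among the `k` positions. -/
theorem sum_first_disagreement_le {k : ℕ} (o v : Fin k → Bool) :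
    ∑ i, (if (∀ j < i, o j = v j) ∧ o i ≠ v i then (1 : ℝ≥0∞) else 0) ≤
      if o = v then 0 else 1 := by
  split_ifs with h
  · simp [h]
  · rw [Finset.sum_boole]
    have : (Finset.univ.filter fun i => (∀ j < i, o j = v j) ∧ o i ≠ v i).card ≤ 1 := by
      refine Finset.card_le_one.2 fun i hi j hj => ?_
      simp only [Finset.mem_filter, Finset.mem_univ, true_and] at hi hj
      rcases lt_trichotomy i j with hij | hij | hij
      · exact absurd (hj.1 i hij) hi.2
      · exact hij
      · exact absurd (hi.1 j hij) hj.2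
    exact_mod_cast this

namespace RandomizedAlgorithm

/-- An algorithm for `f^k` yields an algorithm for `f` which may decline to answer, with error and
cost smaller by a factor of order `k`. -/
theorem exists_declining_algorithm {n k : ℕ} [NeZero k] (f : (Fin n → Bool) → Bool) {ε : ℝ}
    (hε : 0 ≤ ε) (A : RandomizedAlgorithm (Fin k × Fin n) (Fin k → Bool))
    (hA : A.Computes (kFold f k) ε) (hcost : A.averageCost ≠ ∞) :
    ∃ C : RandomizedAlgorithm (Fin n) (Option Bool), ∀ x,
      C.expect (fun T => if T.eval x = some (!f x) then 1 else 0) ≤ 2 * ENNReal.ofReal ε / k ∧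
      C.expect (fun T => if T.eval x = none then 1 else 0) ≤ ENNReal.ofReal ε ∧
      C.expectedQueries x ≤ 2 * A.averageCost / k := by
  rw [A.computes_iff _ hε] at hA
  obtain ⟨P, hP⟩ := exists_embedding_distribution (ι := Fin k) (X := Fin n → Bool)
    (fun i z => A.expect fun T =>
      if (∀ j < i, T.eval (Function.uncurry z) j = f (z j)) ∧
        T.eval (Function.uncurry z) i ≠ f (z i) then 1 else 0)
    (fun i z => A.expect fun T => (T.blockCost i z : ℝ≥0∞))
    (ENNReal.ofReal ε) A.averageCost ENNReal.ofReal_ne_top hcost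
    (fun z => by
      rw [← PMF.expect_sum]
      refine le_trans (A.expect_mono fun T => ?_) (hA (Function.uncurry z))
      exact (sum_first_disagreement_le _ fun i => f (z i)).trans_eq
        (if_congr Iff.rfl rfl rfl))
    (fun z => by
      rw [← PMF.expect_sum]
      refine le_trans (A.expect_mono fun T => ?_) (le_iSup A.expectedQueries (Function.uncurry z))
      rw [← T.sum_blockCost, Nat.cast_sum])
  rw [Fintype.card_fin] at hP
  refine ⟨P.bind fun p => A.map (DecisionTree.probe f p.1 p.2), fun x => ⟨?_, ?_, ?_⟩⟩
  · refine le_trans ?_ (hP x).1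
    simp only [PMF.expect_bind, PMF.expect_map]
    refine P.expect_mono fun p => A.expect_mono fun T => ?_
    rw [DecisionTree.eval_probe]
    by_cases h : ∀ j < p.1, T.eval (Function.uncurry (Function.update p.2 p.1 x)) j =
        f (Function.update p.2 p.1 x j)
    · rw [if_pos h]
      refine le_of_eq (if_congr ?_ rfl rfl)
      rw [and_iff_right h, Option.some_inj, Function.update_self, Bool.eq_not]
    · simp [h]
  · simp only [PMF.expect_bind, PMF.expect_map]
    -- Declining requires an error of `A`, so the bound `ε` holds for every embedding, without
    -- averaging.
    refine P.expect_le fun p => le_trans (A.expect_mono fun T => ?_)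
      (hA (Function.uncurry (Function.update p.2 p.1 x)))
    rw [DecisionTree.eval_probe]
    by_cases h : T.eval (Function.uncurry (Function.update p.2 p.1 x)) =
        kFold f k (Function.uncurry (Function.update p.2 p.1 x))
    · simp [h, kFold]
    · rw [if_neg h]; split_ifs <;> simp
  · refine le_trans ?_ (hP x).2
    rw [expectedQueries_eq]
    simp only [PMF.expect_bind, PMF.expect_map, DecisionTree.card_queried_probe, le_refl]

/-! ### Two runs with a fallback -/

/-- Two runs of an algorithm that may decline to answer, with `B` as a fallback when they do not
agree. -/
noncomputable def twice {ι : Type} (C : RandomizedAlgorithm ι (Option Bool))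
    (B : RandomizedAlgorithm ι Bool) : RandomizedAlgorithm ι Bool :=
  C.bind fun T => C.bind fun T' => B.map (DecisionTree.agreeOr T T')

/-- If the runs do not both answer correctly, then they agree on the wrong answer or `B` is run. -/
theorem expect_twice_le {ι : Type} (C : RandomizedAlgorithm ι (Option Bool))
    (B : RandomizedAlgorithm ι Bool) (F : DecisionTree ι Bool → ℝ≥0∞)
    (F₁ : DecisionTree ι (Option Bool) → ℝ≥0∞) (W V : DecisionTree ι (Option Bool) → ℝ≥0∞)
    (S : DecisionTree ι Bool → ℝ≥0∞)
    (h : ∀ T T' U, F (DecisionTree.agreeOr T T' U) ≤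
      (F₁ T + F₁ T') + W T * W T' + (V T + V T') * S U) :
    (C.twice B).expect F ≤
      2 * C.expect F₁ + C.expect W * C.expect W + 2 * C.expect V * B.expect S := by
  simp only [twice, PMF.expect_bind, PMF.expect_map]
  refine le_trans (C.expect_mono fun T => C.expect_mono fun T' => B.expect_mono (h T T')) ?_
  -- The two runs and the fallback are independent, so expectations of products factor.
  simp only [PMF.expect_add, PMF.expect_const_mul, PMF.expect_mul_const, PMF.expect_const]
  exact le_of_eq (by ring)

/-- A wrong output needs two wrong runs, or a fallback that errs after at least one run was wrong or
declined; the latter is a union bound over the runs. -/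
theorem error_twice_le {ι : Type} (C : RandomizedAlgorithm ι (Option Bool))
    (B : RandomizedAlgorithm ι Bool) (x : ι → Bool) (v : Bool) {e d s : ℝ≥0∞}
    (he : C.expect (fun T => if T.eval x = some (!v) then 1 else 0) ≤ e)
    (hd : C.expect (fun T => if T.eval x = none then 1 else 0) ≤ d)
    (hs : B.expect (fun T => if T.eval x = v then 0 else 1) ≤ s) :
    (C.twice B).expect (fun T => if T.eval x = v then 0 else 1) ≤ e * e + 2 * (e + d) * s := by
  refine le_trans (expect_twice_le C B _ (fun _ => 0)
    (fun T => if T.eval x = some (!v) then 1 else 0)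
    (fun T => (if T.eval x = some (!v) then 1 else 0) + if T.eval x = none then 1 else 0)
    (fun T => if T.eval x = v then 0 else 1) fun T T' U => ?_) ?_
  · simp only [DecisionTree.agreeOr, DecisionTree.eval_bind]
    rcases T.eval x with _ | b <;> rcases T'.eval x with _ | b' <;>
      simp only [] <;> [skip; skip; skip; (cases b <;> cases b')] <;> cases v <;>
      simp [DecisionTree.eval] <;> split_ifs <;> simp
  · rw [PMF.expect_const, PMF.expect_add, mul_zero, zero_add]
    gcongr

theorem expectedQueries_twice_le {ι : Type} [DecidableEq ι]
    (C : RandomizedAlgorithm ι (Option Bool)) (B : RandomizedAlgorithm ι Bool) (x : ι → Bool)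
    (v : Bool) {e d : ℝ≥0∞}
    (he : C.expect (fun T => if T.eval x = some (!v) then 1 else 0) ≤ e)
    (hd : C.expect (fun T => if T.eval x = none then 1 else 0) ≤ d) :
    (C.twice B).expectedQueries x ≤
      2 * C.expectedQueries x + 2 * (e + d) * B.expectedQueries x := by
  simp only [expectedQueries_eq]
  refine le_trans (expect_twice_le C B _ (fun T => ((T.queried x).card : ℝ≥0∞)) (fun _ => 0)
    (fun T => (if T.eval x = some (!v) then 1 else 0) + if T.eval x = none then 1 else 0)
    (fun T => ((T.queried x).card : ℝ≥0∞)) fun T T' U => ?_) ?_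
  · simp only [DecisionTree.agreeOr, DecisionTree.queried_bind]
    refine le_trans (Nat.cast_le.2 ((Finset.card_union_le _ _).trans
      (Nat.add_le_add_left (Finset.card_union_le _ _) _))) ?_
    rw [Nat.cast_add, Nat.cast_add, ← add_assoc, mul_zero, add_zero]
    gcongr
    rcases T.eval x with _ | b <;> rcases T'.eval x with _ | b' <;>
      simp only [] <;> [skip; skip; skip; (cases b <;> cases b')] <;> cases v <;>
      simp [DecisionTree.queried, add_mul]
  · rw [PMF.expect_const, PMF.expect_add, mul_zero, add_zero]
    gcongr

end RandomizedAlgorithm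

/-! ### The recursive inequality and the constants -/

theorem avgQueryComplexity_ne_top {ι α : Type} [Fintype ι] [DecidableEq ι] {ε : ℝ} (hε : 0 ≤ ε)
    (g : (ι → Bool) → α) : avgQueryComplexity ε g ≠ ∞ := by
  let T := DecisionTree.readList g Finset.univ.toList fun _ => false
  let A : RandomizedAlgorithm ι α := PMF.pure T
  have hA : A.Computes g ε := by
    classical
    rw [A.computes_iff g hε]
    intro x
    simp [A, T, PMF.expect_pure, DecisionTree.eval_readList]
  refine ne_top_of_le_ne_top (ENNReal.natCast_ne_top (Fintype.card ι))
    (le_trans (iInf₂_le A hA) (iSup_le fun x => ?_))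
  rw [A.expectedQueries_eq, PMF.expect_pure]
  exact Nat.cast_le.2 (Finset.card_le_univ _)

theorem ENNReal.two_mul_ofReal_div_natCast {k : ℕ} (hk : 0 < k) (ε : ℝ) :
    2 * ENNReal.ofReal ε / k = ENNReal.ofReal (2 * (ε / k)) := by
  rw [ENNReal.ofReal_mul zero_le_two, ENNReal.ofReal_div_of_pos (Nat.cast_pos.2 hk),
    ENNReal.ofReal_natCast, mul_div_assoc, ENNReal.ofReal_ofNat]

theorem ENNReal.one_fifth_eq_ofReal : (1 / 5 : ℝ≥0∞) = ENNReal.ofReal (1 / 5) := by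
  rw [ENNReal.ofReal_div_of_pos (by norm_num)]; simp

/-- Since `ε/k ≤ 1/40`, the square is at most a tenth of `ε/k`. -/
theorem two_run_error_le {k : ℕ} {ε : ℝ} (hk : 2 ≤ k) (hε : 0 ≤ ε) (hε' : ε ≤ 1 / 20) :
    2 * ENNReal.ofReal ε / k * (2 * ENNReal.ofReal ε / k) + 1 / 5 * ENNReal.ofReal (ε / k) ≤
      ENNReal.ofReal (ε / k) := by
  have hk' : (2 : ℝ) ≤ k := by exact_mod_cast hk
  have hdk : 0 ≤ ε / k := by positivity
  have hle : ε / k ≤ 1 / 40 := by rw [div_le_iff₀ (by linarith)]; linarith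
  rw [ENNReal.two_mul_ofReal_div_natCast (by omega), ENNReal.one_fifth_eq_ofReal,
    ← ENNReal.ofReal_mul (by positivity), ← ENNReal.ofReal_mul (by norm_num),
    ← ENNReal.ofReal_add (by positivity) (by positivity)]
  exact ENNReal.ofReal_le_ofReal (by nlinarith)

/-- Tight at `k = 2`, `ε = 1/20`, where both summands in the parentheses equal `1/20`. -/
theorem two_run_fallback_le {k : ℕ} {ε : ℝ} (hk : 2 ≤ k) (hε : 0 ≤ ε) (hε' : ε ≤ 1 / 20) :
    2 * (2 * ENNReal.ofReal ε / k + ENNReal.ofReal ε) ≤ 1 / 5 := by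
  have hk' : (2 : ℝ) ≤ k := by exact_mod_cast hk
  have hle : ε / k ≤ 1 / 40 := by rw [div_le_iff₀ (by linarith)]; linarith
  rw [ENNReal.two_mul_ofReal_div_natCast (by omega), ENNReal.one_fifth_eq_ofReal,
    ← ENNReal.ofReal_add (by positivity) hε, ← ENNReal.ofReal_ofNat 2,
    ← ENNReal.ofReal_mul zero_le_two]
  exact ENNReal.ofReal_le_ofReal (by linarith)

/-- The recursive bound from taking a nearly optimal algorithm for `f` as the fallback. -/
theorem avgQueryComplexity_le_of_computes_kFold {n k : ℕ} (f : (Fin n → Bool) → Bool) {ε : ℝ}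
    (hk : 2 ≤ k) (hε : 0 ≤ ε) (hε' : ε ≤ 1 / 20)
    (A : RandomizedAlgorithm (Fin k × Fin n) (Fin k → Bool)) (hA : A.Computes (kFold f k) ε)
    (hcost : A.averageCost ≠ ∞) :
    avgQueryComplexity (ε / k) f ≤
      4 * A.averageCost / k + 1 / 5 * avgQueryComplexity (ε / k) f := by
  have : NeZero k := ⟨by omega⟩
  have hεk : 0 ≤ ε / k := by positivity
  obtain ⟨C, hC⟩ := A.exists_declining_algorithm f hε hA hcost
  have hB (B : RandomizedAlgorithm (Fin n) Bool) (hB : B.Computes f (ε / k)) :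
      avgQueryComplexity (ε / k) f ≤ 4 * A.averageCost / k + 1 / 5 * B.averageCost := by
    have hcomp : (C.twice B).Computes f (ε / k) := by
      rw [RandomizedAlgorithm.computes_iff _ _ hεk] at hB ⊢
      intro x
      refine (C.error_twice_le B x (f x) (hC x).1 (hC x).2.1 (hB x)).trans
        (le_trans ?_ (two_run_error_le hk hε hε'))
      gcongr
      exact two_run_fallback_le hk hε hε'
    refine le_trans (iInf₂_le (C.twice B) hcomp) (iSup_le fun x => ?_)
    refine le_trans (C.expectedQueries_twice_le B x (f x) (hC x).1 (hC x).2.1) ?_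
    have h4 : 4 * A.averageCost / k = 2 * (2 * A.averageCost / k) := by
      rw [mul_div_assoc, mul_div_assoc, ← mul_assoc]; norm_num
    rw [h4]
    gcongr
    · exact (hC x).2.2
    · exact two_run_fallback_le hk hε hε'
    · exact le_iSup B.expectedQueries x
  -- No optimal `B` need be exhibited: the bound for each `B` passes to the infimum.
  rw [avgQueryComplexity, ENNReal.mul_iInf_of_ne (by simp) (by simp), ENNReal.add_iInf]
  refine le_iInf fun B => ?_
  by_cases h : B.Computes f (ε / k)
  · simpa [h, avgQueryComplexity] using hB B h
  · simp [h, ENNReal.mul_top]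

theorem theorem2 :
    ∃ c : ℝ≥0, 0 < c ∧
      ∀ (n : ℕ) (f : (Fin n → Bool) → Bool) (k : ℕ) (ε : ℝ),
        2 ≤ k → 0 ≤ ε → ε ≤ 1 / 20 →
          (c : ℝ≥0∞) * ((k : ℝ≥0∞) * avgQueryComplexity (ε / (k : ℝ)) f) ≤
            avgQueryComplexity ε (kFold f k) := by
  refine ⟨1 / 5, by norm_num, fun n f k ε hk hε hε' => le_iInf₂ fun A hA => ?_⟩
  by_cases hcost : A.averageCost = ∞
  · simp [hcost]
  have h := avgQueryComplexity_le_of_computes_kFold f hk hε hε' A hA hcost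
  have hkpos : (0 : ℝ) < k := by exact_mod_cast (by omega : 0 < k)
  -- Finiteness allows `R/5` to be subtracted from both sides, leaving `4R/5 ≤ 4q/k`.
  have hR : avgQueryComplexity (ε / k) f ≠ ∞ := avgQueryComplexity_ne_top (by positivity) f
  generalize avgQueryComplexity (ε / k) f = R at *
  generalize A.averageCost = q at *
  lift R to ℝ≥0 using hR
  lift q to ℝ≥0 using hcost
  have hk0 : (k : ℝ≥0) ≠ 0 := by exact_mod_cast hkpos.ne'
  have h' : R ≤ 4 * q / k + 1 / 5 * R := by
    rw [← ENNReal.coe_le_coe]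
    push_cast [ENNReal.coe_div hk0]
    simpa using h
  suffices (1 / 5 : ℝ≥0) * (k * R) ≤ q by
    have := ENNReal.coe_le_coe.2 this
    push_cast at this
    simpa using this
  have h'' : (R : ℝ) ≤ 4 * q / k + 1 / 5 * R := by exact_mod_cast h'
  rw [← NNReal.coe_le_coe]
  push_cast
  have h3 : 4 / 5 * (R : ℝ) ≤ 4 * q / k := by linarith
  rw [le_div_iff₀ hkpos] at h3
  linarith
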